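/- An oriented graph is a directed graph without loops in which any two distinct vertices are joined by at most one directed edge. Let $I_m$ denote the graph on $m$ vertices without edges and $L_n$ the transitive tournament on $n$ vertices, and let $r(I_m, L_n)$ be the least natural number $k$ such that every oriented graph on $k$ vertices contains $I_m$ or $L_n$ as an induced subgraph. For all integers $m, n \geq 2$, the number $r(I_m, L_n)$ exists and $$ r(I_m, L_n) \leq 2^{19n} \cdot \frac{m^{n-1}}{(\log_2 m)^{n-2}}. $$ -/

import Mathlib

/-- An oriented graph on the vertex set `V`: a directed graph without loops and without double
edges, i.e. every edge has exactly one orientation. Loops are excluded by `asymm` with `a = b`. -/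
structure OrientedGraph (V : Type*) where
  /-- `Adj a b` means that there is an edge directed from `a` to `b`. -/
  Adj : V → V → Prop
  asymm : ∀ a b, Adj a b → ¬ Adj b a

namespace OrientedGraph

/-- The oriented graph on `m` vertices without edges, `I_m`. -/
def independent (m : ℕ) : OrientedGraph (Fin m) where
  Adj _ _ := False
  asymm _ _ h := h.elim

/-- The transitive tournament on `n` vertices, `L_n`: vertices `0, …, n - 1`, with an edge from
`i` to `j` exactly when `i < j`. -/
def transTournament (n : ℕ) : OrientedGraph (Fin n) where
  Adj i j := i < j
  asymm _ _ h := lt_asymm h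

/-- `D.Contains S`: the oriented graph `S` is isomorphic to an induced subgraph of `D`. -/
def Contains {V W : Type*} (D : OrientedGraph V) (S : OrientedGraph W) : Prop :=
  Nonempty (S.Adj ↪r D.Adj)

end OrientedGraph

/-- The numbers `k` such that no oriented graph on `k` vertices is `(I_m, L_n)`-free. -/
def orientedRamseySet (m n : ℕ) : Set ℕ :=
  {k | ∀ D : OrientedGraph (Fin k),
    D.Contains (OrientedGraph.independent m) ∨ D.Contains (OrientedGraph.transTournament n)}

/-- The Ramsey number `r(I_m, L_n)`: the least element of `orientedRamseySet m n`. -/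
noncomputable def orientedRamsey (m n : ℕ) : ℕ :=
  sInf (orientedRamseySet m n)

/-! Induct on the length of the forbidden tournament. If `s` contains no transitive tournament on `k
+ 3` vertices, out-neighbourhoods and common out-neighbourhoods of edges avoid shorter ones, so
their sizes are at most some `a` and `b` with `a / b = q`, where `q` is of order `m / log m`. A
random sample of density `1 / (4√(ab))`, after deletions, has no transitive triangle and underlying
degrees at most `d = 8√(a/b)` (`exists_sparse_subset`).

Without transitive triangles, in- and out-neighbourhoods are independent, so every neighbourhood is
a union of two independent sets. A uniformly random independent set then has mean size of order `log
d / d` times the number of vertices, a logarithm better than greedy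
(`exists_isIndepSet_of_neighborhoods_bipartite`). Hence `s` has an independent set of order `#s *
log (a/b) / a`, which reaches `m` once `#s` exceeds the bound. -/

open Finset

/-! ### Random independent sets in graphs with bipartite neighbourhoods -/

/-- Few sets are small: weighting each set by `8 ^ (-#I)` gives total at most `(9/8) ^ #K`, while
convexity bounds the total below in terms of the mean size. A mean below `#K / 16` would make `F`
too small. -/
theorem card_mul_card_le_sum_card {V : Type*} [DecidableEq V] (K : Finset V)
    (F : Finset (Finset V)) (hF : F ⊆ K.powerset) (hcard : 2 ^ #K ≤ #F ^ 2) :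
    (#K : ℝ) * #F ≤ 16 * ∑ I ∈ F, (#I : ℝ) := by
  by_contra! hlt
  set k := #K with hk
  set u : ℝ := k / 16 with hu
  set c : ℝ := Real.log 8 with hc
  have hc0 : 0 < c := Real.log_pos (by norm_num)
  have hec : Real.exp (-c) = 1 / 8 := by
    rw [Real.exp_neg, hc, Real.exp_log (show (0 : ℝ) < 8 by norm_num)]; norm_num
  have hk0 : k ≠ 0 := by
    intro h
    have : (0 : ℝ) ≤ ∑ I ∈ F, (#I : ℝ) := sum_nonneg fun _ _ => Nat.cast_nonneg _
    rw [h] at hlt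
    simp at hlt
    linarith
  have hup : ∑ I ∈ F, (1 / 8 : ℝ) ^ #I ≤ (9 / 8) ^ k := by
    calc ∑ I ∈ F, (1 / 8 : ℝ) ^ #I ≤ ∑ I ∈ K.powerset, (1 / 8 : ℝ) ^ #I :=
          sum_le_sum_of_subset_of_nonneg hF (fun _ _ _ => by positivity)
      _ = ∑ I ∈ K.powerset, (1 / 8 : ℝ) ^ #I * 1 ^ (k - #I) := by simp
      _ = (9 / 8) ^ k := by rw [hk, sum_pow_mul_eq_add_pow]; norm_num
  have hlow : Real.exp (-(u * c)) * #F ≤ ∑ I ∈ F, (1 / 8 : ℝ) ^ #I := by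
    -- Tangent line of the exponential at the hypothetical mean `u`, in place of Jensen's
    -- inequality.
    have h1 : ∀ I ∈ F, Real.exp (-(u * c)) * (1 + c * (u - #I)) ≤ (1 / 8 : ℝ) ^ #I := by
      intro I _
      have h2 : (1 / 8 : ℝ) ^ #I = Real.exp (-(u * c)) * Real.exp (c * (u - #I)) := by
        rw [← hec, ← Real.exp_nat_mul, ← Real.exp_add]
        congr 1; ring
      rw [h2]
      gcongr
      linarith [Real.add_one_le_exp (c * (u - #I))]
    refine le_trans ?_ (sum_le_sum h1)
    rw [← mul_sum]
    gcongr
    simp only [sum_add_distrib, ← mul_sum, sum_sub_distrib, sum_const, nsmul_eq_mul, mul_one]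
    have : 0 ≤ (#F : ℝ) * u - ∑ I ∈ F, (#I : ℝ) := by rw [hu]; linarith
    nlinarith [mul_nonneg hc0.le this]
  have hZ : (#F : ℝ) ≤ Real.exp (u * c) * (9 / 8) ^ k := by
    have h := hlow.trans hup
    rw [Real.exp_neg, inv_mul_le_iff₀ (Real.exp_pos _)] at h
    exact h
  have h16 : (#F : ℝ) ^ 16 ≤ (8 * (9 / 8) ^ 16) ^ k := by
    calc (#F : ℝ) ^ 16 ≤ (Real.exp (u * c) * (9 / 8) ^ k) ^ 16 := by gcongr
      _ = (8 * (9 / 8) ^ 16) ^ k := by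
        rw [mul_pow, mul_pow, ← Real.exp_nat_mul]
        have : ((16 : ℕ) : ℝ) * (u * c) = k * c := by rw [hu]; push_cast; ring
        rw [this, Real.exp_nat_mul, hc, Real.exp_log (show (0 : ℝ) < 8 by norm_num),
          ← pow_mul, ← pow_mul, mul_comm k 16]
  have h256 : (256 : ℝ) ^ k ≤ (#F : ℝ) ^ 16 := by
    have : ((2 : ℝ) ^ k) ≤ (#F : ℝ) ^ 2 := by exact_mod_cast hcard
    calc (256 : ℝ) ^ k = ((2 : ℝ) ^ k) ^ 8 := by rw [← pow_mul, mul_comm, pow_mul]; norm_num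
      _ ≤ ((#F : ℝ) ^ 2) ^ 8 := by gcongr
      _ = _ := by rw [← pow_mul]
  have : (8 * (9 / 8) ^ 16 : ℝ) ^ k < 256 ^ k :=
    pow_lt_pow_left₀ (by norm_num) (by positivity) hk0
  linarith

/-- If `k` is at least half of `logb 2 d`, the term `T` suffices alone; otherwise `Z ≤ √d` and `logb
2 d ≤ 4√d`, so `d` does. -/
theorem logb_mul_one_add_le {d Z T : ℝ} {k : ℕ} (hd : 1 ≤ d) (hZ1 : 1 ≤ Z) (hZ : Z ≤ 2 ^ k)
    (hT : k * Z ≤ 16 * T) (hT0 : 0 ≤ T) : Real.logb 2 d / 64 * (1 + Z) ≤ d + T := by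
  have hl0 : 0 ≤ Real.logb 2 d := Real.logb_nonneg (by norm_num) hd
  set l := Real.logb 2 d with hl
  have hdl : d = 2 ^ l := (Real.rpow_logb (by norm_num) (by norm_num) (by linarith)).symm
  by_cases h : l ≤ 2 * k
  · have h1 : l * Z ≤ 2 * k * Z := by gcongr
    nlinarith
  · push Not at h
    have hs0 : 0 ≤ √d := Real.sqrt_nonneg d
    have hs1 : 1 ≤ √d := by rw [Real.one_le_sqrt]; exact hd
    have hss : √d * √d = d := Real.mul_self_sqrt (by linarith)
    have hZs : Z ≤ √d := by
      apply hZ.trans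
      rw [Real.le_sqrt (by positivity) (by linarith), hdl, ← Real.rpow_natCast, ← Real.rpow_natCast,
        ← Real.rpow_mul (by norm_num)]
      apply Real.rpow_le_rpow_of_exponent_le (by norm_num)
      push_cast; linarith
    have hls : l ≤ 4 * √d := by
      have h2 : Real.log d = 2 * Real.log √d := by
        rw [Real.log_sqrt (by linarith)]; ring
      have h3 := Real.log_le_sub_one_of_pos (show 0 < √d by linarith)
      have h4 := Real.log_two_gt_d9
      rw [hl, Real.logb, div_le_iff₀ (by linarith), h2]
      nlinarith
    have : l * (1 + Z) ≤ 4 * √d * (2 * √d) := by gcongr; linarith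
    nlinarith

open Classical in
-- Condition on `W` outside the closed neighbourhood of `v`. What remains is either `{v}` or an
-- independent subset of the set `K` of neighbours still available. One of `A`, `B` covers half of
-- `K`, so there are at least `2 ^ (#K / 2)` such subsets and their mean size is at least `#K / 16`.
theorem logb_mul_card_fiber_le_sum {V : Type*} (G : SimpleGraph V) (S A B : Finset V) (v : V)
    (hv : v ∈ S) {d : ℝ} (hd : 1 ≤ d) (hA : G.IsIndepSet (A : Set V))
    (hB : G.IsIndepSet (B : Set V)) (hAB : S.filter (G.Adj v) ⊆ A ∪ B) (W₀ : Finset V)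
    (hW₀ : W₀ ⊆ S) (hI₀ : G.IsIndepSet (W₀ : Set V)) (N : Finset V)
    (hN : N = S.filter (G.Adj v)) (Φ : Finset (Finset V))
    (hΦ : Φ = (S.powerset.filter (fun W : Finset V => G.IsIndepSet (W : Set V))).filter
      (fun W => W \ insert v N = W₀ \ insert v N)) :
    Real.logb 2 d / 64 * #Φ ≤ ∑ W ∈ Φ, ((if v ∈ W then d else 0) + (#(W ∩ N) : ℝ)) := by
  set R := W₀ \ insert v N with hR
  have hmemN : ∀ u, u ∈ N ↔ u ∈ S ∧ G.Adj v u := by simp [hN]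
  have hvN : v ∉ N := by simp [hN]
  have hRS : R ⊆ S := sdiff_subset.trans hW₀
  have hRW : R ⊆ W₀ := sdiff_subset
  have hRN : ∀ u ∈ R, u ≠ v ∧ u ∉ N := by
    intro u hu
    simp only [hR, mem_sdiff, mem_insert, not_or] at hu
    exact hu.2
  have hRI : ∀ x ∈ R, ∀ y ∈ R, ¬ G.Adj x y := fun x hx y hy h =>
    hI₀ (hRW hx) (hRW hy) h.ne h
  have hmem : ∀ W, W ∈ Φ ↔ W ⊆ S ∧ G.IsIndepSet (W : Set V) ∧ W \ insert v N = R := by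
    intro W; simp [hΦ, and_assoc]
  have hindep : ∀ W : Finset V, (∀ x ∈ W, ∀ y ∈ W, ¬ G.Adj x y) → G.IsIndepSet (W : Set V) :=
    fun W h x hx y hy _ => h x hx y hy
  have hindep' : ∀ W : Finset V, G.IsIndepSet (W : Set V) → ∀ x ∈ W, ∀ y ∈ W, ¬ G.Adj x y :=
    fun W h x hx y hy hxy => h hx hy hxy.ne hxy
  set Φ₀ := Φ.filter (fun W => v ∉ W) with hΦ₀
  have hΦ₁ : Φ.filter (fun W => v ∈ W) = {insert v R} := by
    ext W
    simp only [mem_filter, hmem, mem_singleton]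
    constructor
    · rintro ⟨⟨hWS, hWI, hWR⟩, hvW⟩
      ext u
      rw [mem_insert, ← hWR, mem_sdiff, mem_insert, hmemN]
      have := hindep' W hWI v hvW u
      by_cases huv : u = v
      · simp [huv, hvW]
      · simp only [huv, false_or]
        exact ⟨fun hu => ⟨hu, fun h => this hu h.2⟩, fun h => h.1⟩
    · rintro rfl
      refine ⟨⟨insert_subset hv hRS, hindep _ ?_, ?_⟩, mem_insert_self _ _⟩
      · have hvR : ∀ x ∈ R, ¬ G.Adj v x := fun x hx h =>
          (hRN x hx).2 ((hmemN x).2 ⟨hRS hx, h⟩)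
        intro x hx y hy h
        rcases mem_insert.1 hx with rfl | hx <;> rcases mem_insert.1 hy with rfl | hy
        · exact h.ne rfl
        · exact hvR _ hy h
        · exact hvR _ hx h.symm
        · exact hRI _ hx _ hy h
      · ext u
        have := hRN u
        simp only [mem_sdiff, mem_insert]
        clear * - this
        tauto
  set F := Φ₀.image (fun W => W ∩ N) with hF
  have hrec : ∀ W ∈ Φ₀, W = R ∪ (W ∩ N) := by
    intro W hW
    obtain ⟨hW, hvW⟩ := mem_filter.1 hW
    rw [← ((hmem W).1 hW).2.2]
    ext u
    simp only [mem_union, mem_sdiff, mem_insert, mem_inter]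
    by_cases huv : u = v
    · simp [huv, hvW]
    · simp only [huv, false_or]
      clear * -
      tauto
  have hinj : Set.InjOn (fun W => W ∩ N) (Φ₀ : Set (Finset V)) := by
    intro W hW W' hW' h
    rw [hrec W hW, hrec W' hW']
    simp only at h
    rw [h]
  have hFcard : #F = #Φ₀ := card_image_of_injOn hinj
  set K := N.filter (fun u => ∀ x ∈ R, ¬ G.Adj x u) with hK
  have hFK : F ⊆ K.powerset := by
    intro J hJ
    obtain ⟨W, hW, rfl⟩ := mem_image.1 hJ
    have hWΦ := (hmem W).1 (mem_filter.1 hW).1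
    rw [mem_powerset]
    intro u hu
    obtain ⟨huW, huN⟩ := mem_inter.1 hu
    refine mem_filter.2 ⟨huN, fun x hx => hindep' W hWΦ.2.1 x ?_ u huW⟩
    rw [← hWΦ.2.2] at hx
    exact (mem_sdiff.1 hx).1
  have hsub : ∀ C : Finset V, G.IsIndepSet (C : Set V) → 2 ^ #(K ∩ C) ≤ #F := by
    intro C hC
    rw [← card_powerset]
    apply card_le_card
    intro J hJ
    rw [mem_powerset] at hJ
    have hJC : ∀ x ∈ J, x ∈ C := fun x hx => (mem_inter.1 (hJ hx)).2
    have hJN : ∀ x ∈ J, x ∈ N := fun x hx => (mem_filter.1 (mem_inter.1 (hJ hx)).1).1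
    have hJR : ∀ x ∈ J, ∀ y ∈ R, ¬ G.Adj y x :=
      fun x hx => (mem_filter.1 (mem_inter.1 (hJ hx)).1).2
    refine mem_image.2 ⟨R ∪ J, mem_filter.2 ⟨(hmem _).2 ⟨?_, hindep _ ?_, ?_⟩, ?_⟩, ?_⟩
    · exact union_subset hRS fun x hx => ((hmemN x).1 (hJN x hx)).1
    · intro x hx y hy h
      rcases mem_union.1 hx with hx | hx <;> rcases mem_union.1 hy with hy | hy
      · exact hRI _ hx _ hy h
      · exact hJR _ hy _ hx h
      · exact hJR _ hx _ hy h.symm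
      · exact hindep' C hC _ (hJC _ hx) _ (hJC _ hy) h
    · ext u
      have h1 := hRN u
      have h2 := hJN u
      simp only [mem_sdiff, mem_union, mem_insert]
      clear * - h1 h2
      tauto
    · intro h
      rcases mem_union.1 h with h | h
      · exact (hRN v h).1 rfl
      · exact hvN (hJN v h)
    · ext u
      have h1 := hRN u
      have h2 := hJN u
      simp only [mem_inter, mem_union]
      clear * - h1 h2
      tauto
  have hKcard : 2 ^ #K ≤ #F ^ 2 := by
    have h1 : #K ≤ #(K ∩ A) + #(K ∩ B) := by
      refine le_trans (card_le_card ?_) (card_union_le _ _)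
      intro u hu
      have huAB : u ∈ A ∪ B := hAB (hN ▸ (mem_filter.1 hu).1)
      simp only [mem_union, mem_inter] at huAB ⊢
      clear * - huAB hu
      tauto
    calc 2 ^ #K ≤ 2 ^ (#(K ∩ A) + #(K ∩ B)) := Nat.pow_le_pow_right (by norm_num) h1
      _ = 2 ^ #(K ∩ A) * 2 ^ #(K ∩ B) := pow_add _ _ _
      _ ≤ #F * #F := Nat.mul_le_mul (hsub A hA) (hsub B hB)
      _ = #F ^ 2 := (sq _).symm
  have hsize := card_mul_card_le_sum_card K F hFK hKcard
  have hF1 : (1 : ℝ) ≤ #F := by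
    have := (hsub A hA).trans' (Nat.one_le_two_pow)
    exact_mod_cast this
  have hF2 : (#F : ℝ) ≤ 2 ^ #K := by
    have := card_le_card hFK
    rw [card_powerset] at this
    exact_mod_cast this
  have hmain := logb_mul_one_add_le hd hF1 hF2 hsize
    (sum_nonneg fun _ _ => Nat.cast_nonneg _)
  have hcardΦ : (#Φ : ℝ) = 1 + #F := by
    rw [hFcard, ← card_filter_add_card_filter_not (s := Φ) (fun W => v ∈ W), hΦ₁]
    simp [hΦ₀]
  have hsumF : ∑ J ∈ F, (#J : ℝ) = ∑ W ∈ Φ₀, (#(W ∩ N) : ℝ) := sum_image hinj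
  rw [hcardΦ, sum_add_distrib, ← sum_filter, hΦ₁, sum_singleton]
  refine hmain.trans ?_
  rw [hsumF]
  exact add_le_add_right (sum_le_sum_of_subset_of_nonneg (filter_subset _ _)
    fun _ _ _ => Nat.cast_nonneg _) _

open Classical in
/-- If every neighbourhood is a union of two independent sets, then the independence number
exceeds the greedy bound by a factor logarithmic in the degree. -/
theorem exists_isIndepSet_of_neighborhoods_bipartite {V : Type*} (G : SimpleGraph V)
    (S : Finset V) {d : ℝ} (hd : 1 ≤ d) (hdeg : ∀ v ∈ S, (#(S.filter (G.Adj v)) : ℝ) ≤ d)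
    (hloc : ∀ v ∈ S, ∃ A B : Finset V, G.IsIndepSet (A : Set V) ∧ G.IsIndepSet (B : Set V) ∧
      S.filter (G.Adj v) ⊆ A ∪ B) :
    ∃ W ⊆ S, G.IsIndepSet (W : Set V) ∧ #S * Real.logb 2 d / (128 * d) ≤ (#W : ℝ) := by
  set 𝓘 := S.powerset.filter (fun W : Finset V => G.IsIndepSet (W : Set V)) with h𝓘
  set N : V → Finset V := fun v => S.filter (G.Adj v) with hN
  have hne : 𝓘.Nonempty := ⟨∅, by simp [h𝓘]⟩
  have hv : ∀ v ∈ S, Real.logb 2 d / 64 * #𝓘 ≤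
      ∑ W ∈ 𝓘, ((if v ∈ W then d else 0) + (#(W ∩ N v) : ℝ)) := by
    intro v hvS
    obtain ⟨A, B, hA, hB, hAB⟩ := hloc v hvS
    set g : Finset V → Finset V := fun W => W \ insert v (N v) with hg
    have hmaps : ∀ W ∈ 𝓘, g W ∈ 𝓘.image g := fun W hW => mem_image_of_mem _ hW
    rw [card_eq_sum_card_fiberwise hmaps, ← sum_fiberwise_of_maps_to hmaps, Nat.cast_sum, mul_sum]
    refine sum_le_sum fun R hR => ?_
    obtain ⟨W₀, hW₀, rfl⟩ := mem_image.1 hR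
    obtain ⟨h1, h2⟩ := mem_filter.1 hW₀
    exact logb_mul_card_fiber_le_sum G S A B v hvS hd hA hB hAB W₀ (mem_powerset.1 h1) h2 (N v)
      rfl _ rfl
  -- The weight `d` on `v ∈ W` balances the double count: each vertex of `W` lies in at most `d`
  -- neighbourhoods.
  have hW : ∀ W ∈ 𝓘, ∑ v ∈ S, ((if v ∈ W then d else 0) + (#(W ∩ N v) : ℝ)) ≤ 2 * d * #W := by
    intro W hW
    have hWS : W ⊆ S := mem_powerset.1 (mem_filter.1 hW).1
    rw [sum_add_distrib]
    have h1 : ∑ v ∈ S, (if v ∈ W then d else 0) = d * #W := by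
      rw [← sum_filter, filter_mem_eq_inter, inter_eq_right.2 hWS]
      simp [mul_comm]
    have h2 : ∑ v ∈ S, (#(W ∩ N v) : ℝ) ≤ d * #W := by
      have h3 : ∑ v ∈ S, #(W ∩ N v) = ∑ w ∈ W, #(N w) := by
        have := sum_card_bipartiteAbove_eq_sum_card_bipartiteBelow (s := S) (t := W) G.Adj
        convert! this using 2 with v hv w hw
        · congr 1; ext u
          simp only [hN, mem_inter, mem_filter, mem_bipartiteAbove]
          exact ⟨fun h => ⟨h.1, h.2.2⟩, fun h => ⟨h.1, hWS h.1, h.2⟩⟩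
        · congr 1; ext u
          simp [hN, G.adj_comm]
      rw [← Nat.cast_sum, h3, Nat.cast_sum, mul_comm, ← nsmul_eq_mul]
      exact sum_le_card_nsmul _ _ _ fun w hw => hdeg w (hWS hw)
    linarith
  have htot : ∑ W ∈ 𝓘, (#S * Real.logb 2 d / 64) ≤ ∑ W ∈ 𝓘, 2 * d * (#W : ℝ) := by
    calc ∑ W ∈ 𝓘, (#S * Real.logb 2 d / 64) = ∑ v ∈ S, Real.logb 2 d / 64 * #𝓘 := by
          simp; ring
      _ ≤ _ := sum_le_sum hv
      _ = _ := sum_comm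
      _ ≤ _ := sum_le_sum hW
  obtain ⟨W, hW𝓘, hle⟩ := exists_le_of_sum_le hne htot
  obtain ⟨h1, h2⟩ := mem_filter.1 hW𝓘
  refine ⟨W, mem_powerset.1 h1, h2, ?_⟩
  rw [div_le_iff₀ (by linarith)]
  linarith

/-! ### Random subsets of density `p` -/

/-- The probability that a `p`-random subset contains `t`. Replacing `1 - p` by `0` on `t` kills
exactly the terms of the product expansion that miss a point of `t`. -/
theorem sum_ite_subset_pow_mul_pow {V : Type*} [DecidableEq V] (s t : Finset V) (hts : t ⊆ s)
    (p : ℝ) :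
    ∑ W ∈ s.powerset, (p ^ #W * (1 - p) ^ #(s \ W)) * (if t ⊆ W then 1 else 0) = p ^ #t := by
  have h := prod_add (fun _ => p) (fun v => if v ∈ t then 0 else 1 - p) s
  have h1 : ∏ v ∈ s, (p + if v ∈ t then 0 else 1 - p) = p ^ #t := by
    rw [← prod_sdiff hts, prod_eq_one, one_mul, prod_congr rfl (g := fun _ => p), prod_const]
    · intro v hv; simp [hv]
    · intro v hv; simp [(mem_sdiff.1 hv).2]
  rw [← h1, h]
  refine sum_congr rfl fun W _ => ?_
  rw [prod_const, mul_assoc]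
  congr 1
  split_ifs with hW
  · rw [mul_one, prod_congr rfl (g := fun _ => 1 - p), prod_const]
    intro v hv
    rw [if_neg fun h => (mem_sdiff.1 hv).2 (hW h)]
  · obtain ⟨v, hvt, hvW⟩ := not_subset.1 hW
    rw [mul_zero, prod_eq_zero (mem_sdiff.2 ⟨hts hvt, hvW⟩)]
    simp [hvt]

theorem exists_subset_le_card_sub {V : Type*} [DecidableEq V] (s : Finset V)
    (E : Finset (V × V)) (T : Finset (V × V × V))
    (hE : ∀ e ∈ E, ({e.1, e.2} : Finset V) ⊆ s ∧ #({e.1, e.2} : Finset V) = 2)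
    (hT : ∀ e ∈ T, ({e.1, e.2.1, e.2.2} : Finset V) ⊆ s ∧
      #({e.1, e.2.1, e.2.2} : Finset V) = 3)
    {p : ℝ} (x y : ℝ) (hp0 : 0 < p) (hp1 : p < 1) :
    ∃ W ⊆ s, p * #s - x * (p ^ 2 * #E) - y * (p ^ 3 * #T) ≤
      #W - x * #(E.filter fun e => ({e.1, e.2} : Finset V) ⊆ W) -
        y * #(T.filter fun e => ({e.1, e.2.1, e.2.2} : Finset V) ⊆ W) := by
  set μ : Finset V → ℝ := fun W => p ^ #W * (1 - p) ^ #(s \ W) with hμ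
  have hμpos : ∀ W, 0 < μ W := fun W => mul_pos (pow_pos hp0 _) (pow_pos (sub_pos.2 hp1) _)
  have h1 : ∑ W ∈ s.powerset, μ W = 1 := by
    have := sum_ite_subset_pow_mul_pow s ∅ (empty_subset _) p
    simpa using this
  have hV : ∑ W ∈ s.powerset, μ W * #W = p * #s := by
    have : ∀ W ∈ s.powerset, μ W * #W = ∑ v ∈ s, μ W * (if {v} ⊆ W then 1 else 0) := by
      intro W hW
      rw [← mul_sum]
      congr 1
      simp only [singleton_subset_iff]
      rw [sum_boole, filter_mem_eq_inter, inter_eq_right.2 (mem_powerset.1 hW)]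
    rw [sum_congr rfl this, sum_comm,
      sum_congr rfl fun v hv => sum_ite_subset_pow_mul_pow s {v} (singleton_subset_iff.2 hv) p]
    simp [mul_comm]
  have hfam : ∀ {ι : Type _} (F : Finset ι) (f : ι → Finset V) (k : ℕ)
      (_ : ∀ i ∈ F, f i ⊆ s ∧ #(f i) = k),
      ∑ W ∈ s.powerset, μ W * #(F.filter fun i => f i ⊆ W) = p ^ k * #F := by
    intro ι F f k hF
    have : ∀ W ∈ s.powerset, μ W * #(F.filter fun i => f i ⊆ W) =
        ∑ i ∈ F, μ W * (if f i ⊆ W then 1 else 0) := by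
      intro W _
      rw [← mul_sum, sum_boole]
    rw [sum_congr rfl this, sum_comm,
      sum_congr rfl fun i hi => sum_ite_subset_pow_mul_pow s (f i) (hF i hi).1 p,
      sum_congr rfl fun i hi => by rw [(hF i hi).2]]
    simp [mul_comm]
  have hE' := hfam E (fun e => {e.1, e.2}) 2 hE
  have hT' := hfam T (fun e => {e.1, e.2.1, e.2.2}) 3 hT
  have hsum : ∑ W ∈ s.powerset, μ W * (p * #s - x * (p ^ 2 * #E) - y * (p ^ 3 * #T)) ≤
      ∑ W ∈ s.powerset, μ W * (#W - x * #(E.filter fun e => ({e.1, e.2} : Finset V) ⊆ W) -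
        y * #(T.filter fun e => ({e.1, e.2.1, e.2.2} : Finset V) ⊆ W)) := by
    rw [← sum_mul, h1, one_mul, ← hV, ← hE', ← hT', mul_sum, mul_sum, ← sum_sub_distrib,
      ← sum_sub_distrib]
    refine (sum_congr rfl fun W _ => ?_).le
    ring
  obtain ⟨W, hW, hle⟩ := exists_le_of_sum_le ⟨∅, empty_mem_powerset s⟩ hsum
  exact ⟨W, mem_powerset.1 hW, le_of_mul_le_mul_left hle (hμpos W)⟩

/-! ### Removing transitive triangles from an oriented graph -/

namespace OrientedGraph

/-- The undirected graph underlying an oriented graph. -/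
def underlying {V : Type*} (D : OrientedGraph V) : SimpleGraph V where
  Adj u v := D.Adj u v ∨ D.Adj v u
  symm := ⟨fun _ _ h => h.symm⟩
  loopless := ⟨fun v h => by rcases h with h | h <;> exact D.asymm v v h h⟩

theorem ne_of_adj {V : Type*} (D : OrientedGraph V) {u v : V} (h : D.Adj u v) : u ≠ v := by
  rintro rfl
  exact D.asymm _ _ h h

open Classical in
theorem exists_sparse_subset {V : Type*} (D : OrientedGraph V) (s : Finset V) {a b : ℝ}
    (ha : 1 ≤ a) (hb : 1 ≤ b) (hout : ∀ v ∈ s, (#(s.filter (D.Adj v)) : ℝ) ≤ a)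
    (hco : ∀ u ∈ s, ∀ v ∈ s, D.Adj u v →
      (#(s.filter fun w => D.Adj u w ∧ D.Adj v w) : ℝ) ≤ b)
    {p : ℝ} (hp : 0 < p) (hp1 : p < 1) (hpab : p ^ 2 * (a * b) = 1 / 16) :
    ∃ W ⊆ s, p * #s / 4 ≤ #W ∧
      (∀ v ∈ W, (#(W.filter (D.underlying.Adj v)) : ℝ) ≤ 32 * (p * a)) ∧
      ∀ u ∈ W, ∀ v ∈ W, ∀ w ∈ W, D.Adj u v → D.Adj u w → ¬ D.Adj v w := by
  set E := (s ×ˢ s).filter fun e => D.Adj e.1 e.2 with hEdef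
  set T := (s ×ˢ s ×ˢ s).filter
    fun e => D.Adj e.1 e.2.1 ∧ D.Adj e.1 e.2.2 ∧ D.Adj e.2.1 e.2.2 with hTdef
  have hE : ∀ e ∈ E, ({e.1, e.2} : Finset V) ⊆ s ∧ #({e.1, e.2} : Finset V) = 2 := by
    intro e he
    simp only [hEdef, mem_filter, mem_product] at he
    refine ⟨?_, card_pair (D.ne_of_adj he.2)⟩
    simp [insert_subset_iff, he.1]
  have hT : ∀ e ∈ T, ({e.1, e.2.1, e.2.2} : Finset V) ⊆ s ∧
      #({e.1, e.2.1, e.2.2} : Finset V) = 3 := by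
    intro e he
    simp only [hTdef, mem_filter, mem_product] at he
    refine ⟨?_, card_eq_three.2 ⟨_, _, _, D.ne_of_adj he.2.1, D.ne_of_adj he.2.2.1,
      D.ne_of_adj he.2.2.2, rfl⟩⟩
    simp [insert_subset_iff, he.1]
  have hEcard : (#E : ℝ) ≤ #s * a := by
    have hmaps : ∀ e ∈ E, e.1 ∈ s := fun e he =>
      (mem_product.1 (mem_filter.1 he).1).1
    rw [card_eq_sum_card_fiberwise hmaps, Nat.cast_sum, ← nsmul_eq_mul]
    refine sum_le_card_nsmul _ _ _ fun v hv => le_trans ?_ (hout v hv)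
    norm_cast
    refine card_le_card_of_injOn Prod.snd ?_ ?_
    · intro e he
      simp only [hEdef, coe_filter, mem_filter, mem_product, Set.mem_ofPred_eq] at he ⊢
      exact ⟨he.1.1.2, he.2 ▸ he.1.2⟩
    · intro e he e' he' h
      simp only [coe_filter, Set.mem_ofPred_eq] at he he'
      exact Prod.ext (he.2.trans he'.2.symm) h
  have hTcard : (#T : ℝ) ≤ #E * b := by
    have hmaps : ∀ e ∈ T, (e.1, e.2.1) ∈ E := by
      intro e he
      simp only [hTdef, hEdef, mem_filter, mem_product] at he ⊢
      tauto
    rw [card_eq_sum_card_fiberwise hmaps, Nat.cast_sum, ← nsmul_eq_mul]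
    refine sum_le_card_nsmul _ _ _ fun v hv => ?_
    simp only [hEdef, mem_filter, mem_product] at hv
    refine le_trans ?_ (hco v.1 hv.1.1 v.2 hv.1.2 hv.2)
    norm_cast
    refine card_le_card_of_injOn (fun e => e.2.2) ?_ ?_
    · rintro e he
      simp only [hTdef, coe_filter, mem_filter, mem_product, Set.mem_ofPred_eq] at he ⊢
      obtain ⟨he, rfl⟩ := he
      exact ⟨he.1.2.2, he.2.2.1, he.2.2.2⟩
    · rintro ⟨x, y, z⟩ he ⟨x', y', z'⟩ he' h
      simp only [coe_filter, Set.mem_ofPred_eq] at he he' h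
      have := he.2.trans he'.2.symm
      simp only [Prod.mk.injEq] at this ⊢
      exact ⟨this.1, this.2, h⟩
  have ha0 : 0 < a := by linarith
  have hb0 : 0 < b := by linarith
  have hpa : 0 < p * a := mul_pos hp ha0
  -- The penalties `1 / (4pa)` per edge and `4` per triangle each cost at most a quarter of the
  -- expected size `p * #s`.
  obtain ⟨W, hWs, hW⟩ := exists_subset_le_card_sub s E T hE hT (1 / (4 * (p * a))) 4 hp hp1
  set EW := E.filter fun e => ({e.1, e.2} : Finset V) ⊆ W with hEW
  set TW := T.filter fun e => ({e.1, e.2.1, e.2.2} : Finset V) ⊆ W with hTW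
  have hlow : p * #s / 2 ≤ p * #s - 1 / (4 * (p * a)) * (p ^ 2 * #E) - 4 * (p ^ 3 * #T) := by
    have h1 : 1 / (4 * (p * a)) * (p ^ 2 * #E) ≤ p * #s / 4 := by
      calc 1 / (4 * (p * a)) * (p ^ 2 * #E) ≤ 1 / (4 * (p * a)) * (p ^ 2 * (#s * a)) := by gcongr
        _ = p * #s / 4 := by field_simp
    have h2 : 4 * (p ^ 3 * #T) ≤ p * #s / 4 := by
      calc 4 * (p ^ 3 * #T) ≤ 4 * (p ^ 3 * (#s * a * b)) := by
            gcongr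
            exact hTcard.trans (by gcongr)
        _ = 4 * p * #s * (p ^ 2 * (a * b)) := by ring
        _ = p * #s / 4 := by rw [hpab]; ring
    linarith
  have hW' := hlow.trans hW
  have hx0 : 0 ≤ 1 / (4 * (p * a)) * (#EW : ℝ) := by positivity
  have hN0 : 0 ≤ p * (#s : ℝ) / 2 := by positivity
  have hTW0 : (0 : ℝ) ≤ #TW := Nat.cast_nonneg _
  have hTWle : 4 * (#TW : ℝ) ≤ #W := by linarith
  have hEWle : (#EW : ℝ) ≤ 4 * (p * a) * #W := by
    have : 1 / (4 * (p * a)) * (#EW : ℝ) ≤ #W := by linarith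
    rwa [one_div, inv_mul_le_iff₀ (by positivity)] at this
  have hWle : p * #s / 2 ≤ #W := by linarith
  -- Delete one vertex of each transitive triangle and all vertices of large degree; by Markov's
  -- inequality each class is at most a quarter of `W`.
  set U₁ := TW.image Prod.fst with hU₁
  set U₂ := W.filter fun v => 32 * (p * a) < (#(W.filter (D.underlying.Adj v)) : ℝ) with hU₂
  have hU₁card : 4 * (#U₁ : ℝ) ≤ #W := by
    have : (#U₁ : ℝ) ≤ #TW := by exact_mod_cast card_image_le
    linarith
  have hEWmem : ∀ e, e ∈ EW ↔ e.1 ∈ W ∧ e.2 ∈ W ∧ D.Adj e.1 e.2 := by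
    intro e
    simp only [hEW, hEdef, mem_filter, mem_product, insert_subset_iff, singleton_subset_iff]
    exact ⟨fun h => ⟨h.2.1, h.2.2, h.1.2⟩,
      fun h => ⟨⟨⟨hWs h.1, hWs h.2.1⟩, h.2.2⟩, h.1, h.2.1⟩⟩
  have hdegsum : ∑ v ∈ W, (#(W.filter (D.underlying.Adj v)) : ℝ) ≤ 2 * #EW := by
    have h1 : ∑ v ∈ W, #(W.filter (D.Adj v)) = #EW := by
      rw [card_eq_sum_card_fiberwise (f := Prod.fst) (t := W) fun e he => ((hEWmem e).1 he).1]
      refine sum_congr rfl fun v hv => ?_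
      refine card_bij' (fun u _ => (v, u)) (fun e _ => e.2) ?_ ?_ ?_ ?_
      · intro u hu
        exact mem_filter.2 ⟨(hEWmem _).2 ⟨hv, mem_filter.1 hu⟩, rfl⟩
      · rintro ⟨x, y⟩ he
        simp only [mem_filter, hEWmem] at he ⊢
        exact ⟨he.1.2.1, he.2 ▸ he.1.2.2⟩
      · intro u hu; rfl
      · rintro ⟨x, y⟩ he
        simp only [mem_filter] at he
        exact Prod.ext he.2.symm rfl
    have h2 : ∑ v ∈ W, #(W.filter fun u => D.Adj u v) = #EW := by
      rw [card_eq_sum_card_fiberwise (f := Prod.snd) (t := W) fun e he => ((hEWmem e).1 he).2.1]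
      refine sum_congr rfl fun v hv => ?_
      refine card_bij' (fun u _ => (u, v)) (fun e _ => e.1) ?_ ?_ ?_ ?_
      · intro u hu
        obtain ⟨huW, huv⟩ := mem_filter.1 hu
        exact mem_filter.2 ⟨(hEWmem _).2 ⟨huW, hv, huv⟩, rfl⟩
      · rintro ⟨x, y⟩ he
        simp only [mem_filter, hEWmem] at he ⊢
        exact ⟨he.1.1, he.2 ▸ he.1.2.2⟩
      · intro u hu; rfl
      · rintro ⟨x, y⟩ he
        simp only [mem_filter] at he
        exact Prod.ext rfl he.2.symm
    have h3 : ∑ v ∈ W, #(W.filter (D.underlying.Adj v)) ≤ 2 * #EW := by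
      calc ∑ v ∈ W, #(W.filter (D.underlying.Adj v))
          ≤ ∑ v ∈ W, (#(W.filter (D.Adj v)) + #(W.filter fun u => D.Adj u v)) := by
            refine sum_le_sum fun v _ => le_trans (card_le_card ?_) (card_union_le _ _)
            intro u hu
            obtain ⟨hu, h | h⟩ := mem_filter.1 hu
            · exact mem_union_left _ (mem_filter.2 ⟨hu, h⟩)
            · exact mem_union_right _ (mem_filter.2 ⟨hu, h⟩)
        _ = 2 * #EW := by rw [sum_add_distrib, h1, h2, two_mul]
    exact_mod_cast h3
  have hU₂card : 4 * (#U₂ : ℝ) ≤ #W := by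
    have h1 : (#U₂ : ℝ) * (32 * (p * a)) ≤ ∑ v ∈ W, (#(W.filter (D.underlying.Adj v)) : ℝ) := by
      rw [← nsmul_eq_mul]
      refine (card_nsmul_le_sum U₂ _ _ fun v hv => (mem_filter.1 hv).2.le).trans ?_
      exact sum_le_sum_of_subset_of_nonneg (filter_subset _ _) fun _ _ _ => Nat.cast_nonneg _
    have h2 : (8 * (p * a)) * (4 * (#U₂ : ℝ)) ≤ (8 * (p * a)) * #W := by linarith
    exact le_of_mul_le_mul_left h2 (by positivity)
  have hmemX : ∀ v, v ∈ W \ (U₁ ∪ U₂) ↔ v ∈ W ∧ v ∉ U₁ ∧ v ∉ U₂ := by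
    intro v; simp only [mem_sdiff, mem_union, not_or]
  refine ⟨W \ (U₁ ∪ U₂), sdiff_subset.trans hWs, ?_, ?_, ?_⟩
  · have h1 : #W ≤ #(W \ (U₁ ∪ U₂)) + (#U₁ + #U₂) :=
      card_le_card_sdiff_add_card.trans (Nat.add_le_add_left (card_union_le _ _) _)
    have h2 : (#W : ℝ) ≤ #(W \ (U₁ ∪ U₂)) + (#U₁ + #U₂) := by exact_mod_cast h1
    linarith
  · intro v hv
    obtain ⟨hvW, -, hv₂⟩ := (hmemX v).1 hv
    have h1 : (#(W.filter (D.underlying.Adj v)) : ℝ) ≤ 32 * (p * a) := by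
      by_contra! h
      exact hv₂ (mem_filter.2 ⟨hvW, h⟩)
    refine le_trans ?_ h1
    norm_cast
    exact card_le_card (filter_subset_filter _ sdiff_subset)
  · intro u hu v hv w hw huv huw hvw
    obtain ⟨huW, hu₁, -⟩ := (hmemX u).1 hu
    have hvW := ((hmemX v).1 hv).1
    have hwW := ((hmemX w).1 hw).1
    refine hu₁ (mem_image.2 ⟨(u, v, w), mem_filter.2 ⟨mem_filter.2 ⟨?_, huv, huw, hvw⟩, ?_⟩, rfl⟩)
    · simp [hWs huW, hWs hvW, hWs hwW]
    · simp [insert_subset_iff, huW, hvW, hwW]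

open Classical in
theorem exists_isIndepSet_of_codegree_le {V : Type*} (D : OrientedGraph V) (s : Finset V)
    {a b : ℝ} (hb : 1 ≤ b) (hba : b ≤ a) (hout : ∀ v ∈ s, (#(s.filter (D.Adj v)) : ℝ) ≤ a)
    (hco : ∀ u ∈ s, ∀ v ∈ s, D.Adj u v →
      (#(s.filter fun w => D.Adj u w ∧ D.Adj v w) : ℝ) ≤ b) :
    ∃ W ⊆ s, D.underlying.IsIndepSet (W : Set V) ∧
      #s * Real.logb 2 (a / b) / (2 ^ 15 * a) ≤ (#W : ℝ) := by
  have ha : 1 ≤ a := hb.trans hba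
  have hab1 : 1 ≤ a * b := one_le_mul_of_one_le_of_one_le ha hb
  have hsq : √(a * b) ^ 2 = a * b := Real.sq_sqrt (by linarith)
  have hs1 : 1 ≤ √(a * b) := Real.one_le_sqrt.2 hab1
  set p := 1 / (4 * √(a * b)) with hp
  have hp0 : 0 < p := by positivity
  have hp1 : p < 1 := by
    rw [hp, div_lt_one (by positivity)]; linarith
  have hpab : p ^ 2 * (a * b) = 1 / 16 := by
    rw [hp, div_pow, mul_pow, hsq]; field_simp; norm_num
  obtain ⟨X, hXs, hXcard, hXdeg, hXT⟩ := D.exists_sparse_subset s ha hb hout hco hp0 hp1 hpab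
  have hd2 : (32 * (p * a)) ^ 2 = 64 * (a / b) := by
    have h1 : p ^ 2 = 1 / (16 * (a * b)) := by field_simp; linarith
    rw [mul_pow, mul_pow, h1]; field_simp; norm_num
  set d := 32 * (p * a) with hd
  have hd0 : 0 < d := by positivity
  have hab : 1 ≤ a / b := by rw [one_le_div (by linarith)]; exact hba
  have hd1 : 1 ≤ d := by nlinarith
  have hlog : Real.logb 2 (a / b) / 2 ≤ Real.logb 2 d := by
    have h1 : Real.logb 2 (d ^ 2) = 2 * Real.logb 2 d := by
      rw [Real.logb_pow]; norm_num
    have h2 : Real.logb 2 (a / b) ≤ Real.logb 2 (d ^ 2) :=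
      Real.logb_le_logb_of_le (by norm_num) (by linarith) (by rw [hd2]; linarith)
    linarith
  -- An edge inside the out- or in-neighbourhood of `v` would complete a transitive triangle.
  obtain ⟨W, hWX, hWI, hWcard⟩ := exists_isIndepSet_of_neighborhoods_bipartite D.underlying X hd1
    hXdeg (fun v hv => ⟨X.filter (D.Adj v), X.filter (fun u => D.Adj u v), by
      intro x hx y hy _ h
      simp only [coe_filter, Set.mem_ofPred_eq] at hx hy
      rcases h with h | h
      · exact hXT v hv x hx.1 y hy.1 hx.2 hy.2 h
      · exact hXT v hv y hy.1 x hx.1 hy.2 hx.2 h, by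
      intro x hx y hy _ h
      simp only [coe_filter, Set.mem_ofPred_eq] at hx hy
      rcases h with h | h
      · exact hXT x hx.1 y hy.1 v hv h hx.2 hy.2
      · exact hXT y hy.1 x hx.1 v hv h hy.2 hx.2, by
      intro u hu
      obtain ⟨hu, h | h⟩ := mem_filter.1 hu
      · exact mem_union_left _ (mem_filter.2 ⟨hu, h⟩)
      · exact mem_union_right _ (mem_filter.2 ⟨hu, h⟩)⟩)
  refine ⟨W, hWX.trans hXs, hWI, le_trans ?_ hWcard⟩
  have hl0 : 0 ≤ Real.logb 2 (a / b) := Real.logb_nonneg (by norm_num) hab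
  calc #s * Real.logb 2 (a / b) / (2 ^ 15 * a)
      = (p * #s / 4) * (Real.logb 2 (a / b) / 2) / (128 * d) := by
        rw [hd]; field_simp; ring
    _ ≤ #X * Real.logb 2 d / (128 * d) := by gcongr

end OrientedGraph

/-! ### Induction on the length of the tournament -/

theorem logb_two_le_mul {x : ℝ} (hx : 0 < x) : Real.logb 2 x ≤ 7 / 8 * x := by
  -- Tangent line of the logarithm at `2`.
  have h1 := Real.log_le_sub_one_of_pos (half_pos hx)
  rw [Real.log_div hx.ne' (by norm_num)] at h1
  have h2 := Real.log_two_gt_d9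
  have h3 := Real.log_two_lt_d9
  rw [Real.logb, div_le_iff₀ (by linarith)]
  nlinarith

namespace OrientedGraph

theorem contains_independent_of_isIndepSet {V : Type*} (D : OrientedGraph V) {m : ℕ}
    {t : Finset V} (ht : D.underlying.IsIndepSet (t : Set V)) (hmt : m ≤ #t) :
    D.Contains (independent m) := by
  obtain ⟨f⟩ : Nonempty (Fin m ↪ t) :=
    Function.Embedding.nonempty_of_card_le (by simpa using hmt)
  refine ⟨⟨f.trans (Function.Embedding.subtype _), ?_⟩⟩
  intro i j
  refine ⟨fun h => ?_, fun h => h.elim⟩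
  exact ht (f i).2 (f j).2 (D.ne_of_adj h) (Or.inl h)

theorem contains_transTournament_of_pairwise {V : Type*} (D : OrientedGraph V) {l : List V}
    (hl : l.Pairwise D.Adj) : D.Contains (transTournament l.length) := by
  have hlt : ∀ i j : Fin l.length, i < j → D.Adj (l.get i) (l.get j) :=
    fun i j h => List.pairwise_iff_get.1 hl i j h
  have hinj : Function.Injective l.get := by
    intro i j h
    rcases lt_trichotomy i j with hij | hij | hij
    · exact absurd h (D.ne_of_adj (hlt i j hij))
    · exact hij
    · exact absurd h.symm (D.ne_of_adj (hlt j i hij))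
  refine ⟨⟨⟨l.get, hinj⟩, ?_⟩⟩
  intro i j
  refine ⟨fun h => ?_, hlt i j⟩
  rcases lt_trichotomy i j with hij | hij | hij
  · exact hij
  · exact absurd (congrArg l.get hij) (D.ne_of_adj h)
  · exact absurd h (D.asymm _ _ (hlt j i hij))

/-- Codegrees refer back two lengths, hence the two-step induction. Stating it for subsets `s` makes
it apply to neighbourhoods, and the `+ 1` survives rounding down in the final bound. -/
theorem card_add_one_le_of_free {V : Type*} (D : OrientedGraph V) {m : ℕ} (hm : 2 ≤ m)
    (hI : ∀ t : Finset V, D.underlying.IsIndepSet (t : Set V) → #t < m) (k : ℕ) :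
    ∀ s : Finset V, (∀ l : List V, l.Pairwise D.Adj → (∀ v ∈ l, v ∈ s) → l.length ≠ k + 1) →
      (#s : ℝ) + 1 ≤ 2 ^ 19 * Real.logb 2 m * (2 ^ 19 * m / Real.logb 2 m) ^ k := by
  classical
  have hm2 : (2 : ℝ) ≤ m := by exact_mod_cast hm
  have hL1 : 1 ≤ Real.logb 2 m := by
    rw [Real.le_logb_iff_rpow_le (by norm_num) (by linarith)]; simpa using hm2
  have hLm := logb_two_le_mul (show (0 : ℝ) < m by linarith)
  set L := Real.logb 2 (m : ℝ) with hL
  set q := 2 ^ 19 * (m : ℝ) / L with hq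
  have hL0 : 0 < L := by linarith
  have hq1 : 1 ≤ q := by rw [hq, one_le_div hL0]; linarith
  have hqL : q * L = 2 ^ 19 * m := by rw [hq]; field_simp
  have hF1 : ∀ j, 2 ^ 19 ≤ 2 ^ 19 * L * q ^ j := by
    intro j
    have := one_le_pow₀ hq1 (n := j)
    nlinarith
  have hlogq : L / 8 ≤ Real.logb 2 q := by
    have h1 : Real.logb 2 q = 19 + L - Real.logb 2 L := by
      rw [hq, Real.logb_div (by positivity) hL0.ne', Real.logb_mul (by norm_num) (by linarith),
        Real.logb_pow, Real.logb_self_eq_one (by norm_num)]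
      norm_num [hL]
    have h2 := logb_two_le_mul hL0
    linarith
  induction k using Nat.twoStepInduction with
  | zero =>
    intro s hs
    have : s = ∅ := by
      rw [eq_empty_iff_forall_notMem]
      intro v hv
      exact hs [v] (by simp) (by simpa using hv) rfl
    have := hF1 0
    simp_all
    linarith
  | one =>
    intro s hs
    have : #s < m := by
      refine hI s fun u hu v hv _ h => ?_
      rcases h with h | h
      · exact hs [u, v] (by simpa using h) (by simp_all) rfl
      · exact hs [v, u] (by simpa using h) (by simp_all) rfl
    have : (#s : ℝ) + 1 ≤ m := by exact_mod_cast this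
    have h2 : 2 ^ 19 * L * q ^ 1 = 2 ^ 19 * (2 ^ 19 * m) := by rw [← hqL]; ring
    rw [h2]
    linarith
  | more k ih₀ ih₁ =>
    intro s hs
    by_contra! hlt
    have hout : ∀ v ∈ s, (#(s.filter (D.Adj v)) : ℝ) ≤ 2 ^ 19 * L * q ^ (k + 1) := by
      intro v hv
      have := ih₁ (s.filter (D.Adj v)) fun l hl hls hlen => by
        refine hs (v :: l) (List.pairwise_cons.2 ⟨fun w hw => (mem_filter.1 (hls w hw)).2, hl⟩)
          ?_ (by simp [hlen])
        intro w hw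
        rcases List.mem_cons.1 hw with rfl | hw
        · exact hv
        · exact (mem_filter.1 (hls w hw)).1
      linarith
    have hco : ∀ u ∈ s, ∀ v ∈ s, D.Adj u v →
        (#(s.filter fun w => D.Adj u w ∧ D.Adj v w) : ℝ) ≤ 2 ^ 19 * L * q ^ k := by
      intro u hu v hv huv
      have := ih₀ (s.filter fun w => D.Adj u w ∧ D.Adj v w) fun l hl hls hlen => by
        refine hs (u :: v :: l) (List.pairwise_cons.2 ⟨?_, List.pairwise_cons.2
          ⟨fun w hw => (mem_filter.1 (hls w hw)).2.2, hl⟩⟩) ?_ (by simp [hlen])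
        · intro w hw
          rcases List.mem_cons.1 hw with rfl | hw
          · exact huv
          · exact (mem_filter.1 (hls w hw)).2.1
        · intro w hw
          rcases List.mem_cons.1 hw with rfl | hw
          · exact hu
          rcases List.mem_cons.1 hw with rfl | hw
          · exact hv
          · exact (mem_filter.1 (hls w hw)).1
      linarith
    have hb := hF1 k
    have ha := hF1 (k + 1)
    have hc := hF1 (k + 2)
    have hab : 2 ^ 19 * L * q ^ (k + 1) = q * (2 ^ 19 * L * q ^ k) := by ring
    have hca : 2 ^ 19 * L * q ^ (k + 2) = q * (2 ^ 19 * L * q ^ (k + 1)) := by ring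
    set a := 2 ^ 19 * L * q ^ (k + 1)
    set b := 2 ^ 19 * L * q ^ k
    rw [hca] at hlt hc
    have hb0 : 0 < b := by linarith
    have ha0 : 0 < a := by linarith
    have hdiv : a / b = q := by rw [hab]; field_simp
    obtain ⟨W, -, hWI, hW⟩ := D.exists_isIndepSet_of_codegree_le s (by linarith)
      (by rw [hab]; nlinarith) hout hco
    have hWm : (#W : ℝ) < m := by exact_mod_cast hI W hWI
    rw [hdiv] at hW
    -- The negated bound gives only `q * a < #s + 1`; the factor `1/2` absorbs the `1`.
    have hs2 : q * a / 2 ≤ #s := by linarith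
    have : (m : ℝ) ≤ #s * Real.logb 2 q / (2 ^ 15 * a) := by
      -- The exponent is `19 = 15 + 1 + 3`: from the independent set bound, the halving of `q * a`,
      -- and `L / 8 ≤ logb 2 q`.
      calc (m : ℝ) = q * L / 2 ^ 19 := by rw [hqL]; field_simp
        _ = (q * a / 2) * (L / 8) / (2 ^ 15 * a) := by field_simp; norm_num
        _ ≤ #s * Real.logb 2 q / (2 ^ 15 * a) := by gcongr
    linarith

end OrientedGraph

theorem theorem3 (m n : ℕ) (hm : 2 ≤ m) (hn : 2 ≤ n) :
    (orientedRamseySet m n).Nonempty ∧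
      (orientedRamsey m n : ℝ) ≤
        (2 : ℝ) ^ (19 * n) * ((m : ℝ) ^ (n - 1) / (Real.logb 2 (m : ℝ)) ^ (n - 2)) := by
  have hL0 : 0 < Real.logb 2 (m : ℝ) := Real.logb_pos (by norm_num) (by exact_mod_cast hm)
  set B : ℝ := (2 : ℝ) ^ (19 * n) * ((m : ℝ) ^ (n - 1) / (Real.logb 2 (m : ℝ)) ^ (n - 2)) with hB
  have hB0 : 0 ≤ B := by positivity
  have hBF : 2 ^ 19 * Real.logb 2 m * (2 ^ 19 * m / Real.logb 2 m) ^ (n - 1) = B := by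
    obtain ⟨j, rfl⟩ := Nat.exists_eq_add_of_le' hn
    rw [hB, show j + 2 - 1 = j + 1 from rfl, show j + 2 - 2 = j from rfl, pow_mul]
    generalize (2 : ℝ) ^ 19 = c
    rw [div_pow, mul_pow]
    field_simp
    ring
  have hmem : ⌊B⌋₊ ∈ orientedRamseySet m n := by
    intro D
    by_contra! hfree
    have hI : ∀ t : Finset (Fin ⌊B⌋₊), D.underlying.IsIndepSet (t : Set _) → #t < m := by
      intro t ht
      by_contra! h
      exact hfree.1 (D.contains_independent_of_isIndepSet ht h)
    have h := D.card_add_one_le_of_free hm hI (n - 1) univ fun l hl _ hlen => by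
      have := D.contains_transTournament_of_pairwise hl
      rw [hlen, Nat.sub_add_cancel (by omega)] at this
      exact hfree.2 this
    rw [hBF, card_univ, Fintype.card_fin] at h
    exact absurd (Nat.lt_floor_add_one B) (not_lt.2 h)
  refine ⟨⟨_, hmem⟩, ?_⟩
  calc (orientedRamsey m n : ℝ) ≤ (⌊B⌋₊ : ℝ) := by exact_mod_cast Nat.sInf_le hmem
    _ ≤ B := Nat.floor_le hB0
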